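/- Consider a chain of UAVs in which the cloud $c$ injects downlink packets at the gateway UAV (the UAV at which the route from the cloud starts, also written $c$), and UAV $i$ forwards downlink packets to UAV $i-1$ over an air channel until they reach UAV $d<c$, which delivers them to its IoT devices over a ground channel. Time is slotted and each channel is used in successive transmission cycles. On the air channel of UAV $i$, each cycle is given to the downlink, uplink or beacon class with probabilities $f^A_{D_i}>0$, $f^A_{U_i}$, $f^A_{B_i}=1-f^A_{U_i}-f^A_{D_i}$, and on the ground channel of UAV $d$ to the downlink or beacon class with probabilities $f^G_{D_d}>0$, $f^G_{B_d}=1-f^G_{D_d}$, independently of the past and of the service times; a downlink cycle with no downlink packet waiting carries a beacon, and a cycle given to the uplink or beacon class takes a service time of that class. Downlink packets for a channel are served first come, first served. Service times have general distributions, are independent of the past, and have finite class means $\tau^A_{D_i},\tau^A_{U_i},\tau^A_{B_i}$ and $\tau^G_{D_d},\tau^G_{B_d}$; put $$\tau^A_{(B,U)_i}=\frac{\tau^A_{B_i}f^A_{B_i}+\tau^A_{U_i}f^A_{U_i}}{f^A_{B_i}+f^A_{U_i}}$$ (if $f^A_{D_i}=1$, the terms containing $\tau^A_{(B,U)_i}$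 below are read as $0$). Inter-arrival times are general. Assume steady state with long-run arrival rates $a^A_i,a^G_d>0$ of the downlink packets for the respective channel and mean residual times $\overline R^A_i,\overline R^G_d$ (mean remaining duration, at the arrival of a downlink packet, of the cycle in progress). Here steady state means that the mean waiting times exist, with the same value along almost every sample path and in expectation, and that the mean number of waiting packets found by an arriving packet equals the time-average number of waiting packets. Assume also stability, i.e. that all denominators $1-a\,[\cdots]$ below are positive. Then the mean sojourn delays $D_i^{\downarrow}$ (waiting plus service time) of downlink packets exist at every hop, and the mean downlink end-to-end delay from $c$ to the IoT devices served by UAV $d$, i.e. the sum of these mean sojourn delays over the air hops $i=c,c-1,\dots,d+1$ and the final ground hop at $d$, is $$D^{\downarrow}_{c,d}=\sum_{i=d+1}^{c}\left[\frac{\overline R^A_i+\frac{1-f^A_{D_i}}{f^A_{D_i}}\,\tau^A_{(B,U)_i}}{1-a^A_i\left[\tau^A_{D_i}+\frac{1-f^A_{D_i}}{f^A_{D_i}}\,\tau^A_{(B,U)_i}\right]}+\tau^A_{D_i}\right]+\frac{\overline R^G_d+\frac{1-f^G_{D_d}}{f^G_{D_d}}\,\tau^G_{B_d}}{1-a^G_d\left[\tau^G_{D_d}+\frac{1-f^G_{D_d}}{f^G_{D_d}}\,\tau^G_{B_d}\right]}+\tau^G_{D_d}.$$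 -/

import Mathlib

open MeasureTheory ProbabilityTheory Filter Topology

/-- The classes of packets that compete for a channel of a UAV. -/
inductive TrafficClass where
  | downlink
  | uplink
  | beacon
  deriving DecidableEq

instance : MeasurableSpace TrafficClass := ⊤

/-- The random data that drive one transmission channel (air or ground) of one UAV, in slotted
time. Transmission cycles `0, 1, 2, …` follow each other without gaps, from slot `0` on. -/
structure ChannelData (Ω : Type*) where
  /-- the class drawn by the scheduler at the start of cycle `m` -/
  pick : ℕ → Ω → TrafficClass
  /-- number of slots that cycle `m` lasts if it carries a packet of class `c` -/
  len : TrafficClass → ℕ → Ω → ℕ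
  /-- slot at whose beginning the `k`-th downlink packet destined for this channel arrives -/
  arr : ℕ → Ω → ℕ

namespace ChannelData

/-- `(T, S)` at the start of cycle `m`: its first slot `T`, and the number `S` of downlink packets
whose transmission started in an earlier cycle. The head-of-line downlink packet is transmitted if
the downlink class is drawn and the packet has arrived; if the downlink class is drawn while no
downlink packet is waiting, a beacon is sent. -/
def state {Ω : Type*} (Q : ChannelData Ω) : ℕ → Ω → ℕ × ℕ
  | 0, _ => (0, 0)
  | m + 1, ω =>
    let T := (Q.state m ω).1
    let S := (Q.state m ω).2
    match Q.pick m ω with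
    | .downlink =>
      if Q.arr S ω ≤ T then (T + Q.len .downlink m ω, S + 1) else (T + Q.len .beacon m ω, S)
    | .uplink => (T + Q.len .uplink m ω, S)
    | .beacon => (T + Q.len .beacon m ω, S)

/-- First slot of cycle `m`. -/
def cycleStart {Ω : Type*} (Q : ChannelData Ω) (m : ℕ) (ω : Ω) : ℕ := (Q.state m ω).1

/-- Number of downlink packets whose transmission started before cycle `m`. -/
def served {Ω : Type*} (Q : ChannelData Ω) (m : ℕ) (ω : Ω) : ℕ := (Q.state m ω).2

/-- The cycle in which the `k`-th downlink packet is transmitted (first come, first served). -/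
noncomputable def serviceCycle {Ω : Type*} (Q : ChannelData Ω) (k : ℕ) (ω : Ω) : ℕ :=
  sInf {m | k < Q.served (m + 1) ω}

/-- The slot in which the transmission of the `k`-th downlink packet starts. -/
noncomputable def serviceStart {Ω : Type*} (Q : ChannelData Ω) (k : ℕ) (ω : Ω) : ℕ :=
  Q.cycleStart (Q.serviceCycle k ω) ω

/-- Waiting time of the `k`-th downlink packet. -/
noncomputable def waiting {Ω : Type*} (Q : ChannelData Ω) (k : ℕ) (ω : Ω) : ℝ :=
  (Q.serviceStart k ω : ℝ) - Q.arr k ω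

/-- Sojourn delay of the `k`-th downlink packet: its waiting time plus its service time. -/
noncomputable def sojourn {Ω : Type*} (Q : ChannelData Ω) (k : ℕ) (ω : Ω) : ℝ :=
  Q.waiting k ω + Q.len .downlink (Q.serviceCycle k ω) ω

/-- Residual time seen by the `k`-th downlink packet: time from its arrival to the end of the cycle
then in progress, i.e. to the next start of a cycle (`0` if a cycle starts in that very slot). -/
noncomputable def residual {Ω : Type*} (Q : ChannelData Ω) (k : ℕ) (ω : Ω) : ℝ :=
  (Q.cycleStart (sInf {m | Q.arr k ω ≤ Q.cycleStart m ω}) ω : ℝ) - Q.arr k ω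

/-- Number of earlier downlink packets still waiting when the `k`-th one arrives. -/
noncomputable def found {Ω : Type*} (Q : ChannelData Ω) (k : ℕ) (ω : Ω) : ℝ :=
  (((Finset.range k).filter fun j => Q.arr k ω ≤ Q.serviceStart j ω).card : ℝ)

/-- Number of downlink packets waiting for this channel in slot `s`. -/
noncomputable def queueLength {Ω : Type*} (Q : ChannelData Ω) (s : ℕ) (ω : Ω) : ℝ :=
  ({j | Q.arr j ω ≤ s ∧ s < Q.serviceStart j ω}.ncard : ℝ)

/-- Number of downlink packets that arrive before slot `t`. -/
noncomputable def numArrivals {Ω : Type*} (Q : ChannelData Ω) (t : ℕ) (ω : Ω) : ℝ :=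
  ({k | Q.arr k ω < t}.ncard : ℝ)

end ChannelData

/-- A channel of a UAV together with its probability law. In each cycle the scheduler draws class
`c` with probability `f c`, independently of the past and of the service times; service times have
general distributions, with mean `tau c` for class `c`. Inter-arrival times are general: arrivals
may depend on everything that happened before, at this UAV or elsewhere. -/
structure DownlinkChannel {Ω : Type*} [mΩ : MeasurableSpace Ω] (μ : Measure Ω) extends
    ChannelData Ω where
  /-- scheduling probabilities -/
  f : TrafficClass → ℝ
  /-- mean service times -/
  tau : TrafficClass → ℝ
  /-- `hist m` is the history up to the start of cycle `m` -/
  hist : Filtration ℕ mΩ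
  arr_mono : ∀ ω, Monotone fun k => arr k ω
  arr_measurable : ∀ k, Measurable (arr k)
  pick_hist : ∀ m, Measurable[hist (m + 1)] (pick m)
  len_hist : ∀ c m, Measurable[hist (m + 1)] (len c m)
  arr_hist : ∀ k m,
    MeasurableSet[hist m] {ω | arr k ω ≤ toChannelData.cycleStart m ω}
  len_pos : ∀ c m ω, 1 ≤ len c m ω
  indep_hist : ∀ m, Indep
    (MeasurableSpace.comap (fun ω => (pick m ω, fun c => len c m ω)) inferInstance) (hist m) μ
  indep_pick_len : ∀ m, IndepFun (pick m) (fun ω c => len c m ω) μ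
  prob_pick : ∀ c m, μ.real {ω | pick m ω = c} = f c
  len_integrable : ∀ c m, Integrable (fun ω => (len c m ω : ℝ)) μ
  mean_len : ∀ c m, ∫ ω, (len c m ω : ℝ) ∂μ = tau c

/-- The mean service time of the beacon and uplink packets served before the downlink packet at the
head of the queue. -/
noncomputable def DownlinkChannel.tauBU {Ω : Type*} [MeasurableSpace Ω] {μ : Measure Ω}
    (Q : DownlinkChannel μ) : ℝ :=
  (Q.tau .beacon * Q.f .beacon + Q.tau .uplink * Q.f .uplink) / (Q.f .beacon + Q.f .uplink)

/-- `x` is the long-run mean of `X 0, X 1, …` in expectation. -/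
def HasMean {Ω : Type*} [MeasurableSpace Ω] (μ : Measure Ω) (X : ℕ → Ω → ℝ) (x : ℝ) : Prop :=
  (∀ k, Integrable (X k) μ) ∧
    Tendsto (fun n : ℕ => (∑ k ∈ Finset.range n, ∫ ω, X k ω ∂μ) / n) atTop (𝓝 x)

/-- `x` is the long-run average of `X 0, X 1, …` along almost every sample path. -/
def HasPathMean {Ω : Type*} [MeasurableSpace Ω] (μ : Measure Ω) (X : ℕ → Ω → ℝ) (x : ℝ) : Prop :=
  ∀ᵐ ω ∂μ, Tendsto (fun n : ℕ => (∑ k ∈ Finset.range n, X k ω) / n) atTop (𝓝 x)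

/-- The channel is in steady state, with arrival rate `a` (packets per slot) and mean residual time
`R`: the waiting time has a mean (the same along sample paths and in expectation), and arriving
packets see time averages, i.e. the mean number of waiting packets that a packet finds on arrival
is the time-average number of waiting packets. -/
structure DownlinkChannel.SteadyState {Ω : Type*} [MeasurableSpace Ω] {μ : Measure Ω}
    (Q : DownlinkChannel μ) (a R : ℝ) : Prop where
  rate_pos : 0 < a
  rate : ∀ᵐ ω ∂μ, Tendsto (fun t : ℕ => Q.numArrivals t ω / t) atTop (𝓝 a)
  mean_residual : HasMean μ Q.residual R
  mean_waiting : ∃ w, HasMean μ Q.waiting w ∧ HasPathMean μ Q.waiting w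
  sees_time_averages : ∃ N, HasMean μ Q.found N ∧ HasPathMean μ Q.queueLength N

/-- `D` is the mean downlink end-to-end delay from the cloud, which enters the network at UAV `c`,
to the IoT devices served by UAV `d`: the sum of the mean sojourn delays at the UAVs
`c, c - 1, …, d + 1`, which forward over the air channel, and at UAV `d`, which delivers over the
ground channel. -/
def IsMeanDownlinkDelay {Ω : Type*} [MeasurableSpace Ω] {μ : Measure Ω}
    (air ground : ℕ → DownlinkChannel μ) (c d : ℕ) (D : ℝ) : Prop :=
  ∃ (DA : ℕ → ℝ) (DG : ℝ),
    (∀ i ∈ Finset.Icc (d + 1) c, HasMean μ (air i).sojourn (DA i)) ∧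
    HasMean μ (ground d).sojourn DG ∧
    D = ∑ i ∈ Finset.Icc (d + 1) c, DA i + DG

/-!
The mean delay at each hop satisfies the linear equation of a mean value analysis, which is proved
here for one channel; the end-to-end delay is a finite sum of such terms.

Let `T m` be the start of cycle `m` and `S m` the number of downlink packets served before it. The
`k`-th packet is present in the cycles `m` with `arr k ≤ T m` and `S m ≤ k`; these form an
interval, ending with its own transmission, and every downlink cycle in it serves a packet. Hence

* its sojourn delay is its residual time plus the lengths of these cycles
  (`ChannelData.sojourn_eq`),
* the number of downlink cycles among them is the number of packets it found waiting, plus one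
  (`ChannelData.found_add_one_eq`).

The events `present k m` belong to the history before cycle `m`, so Wald's identity
(`integral_of_hasSum_indicator_draw`) turns both facts into equations for the expected number of
cycles with the packet present. Eliminating that number gives
`E sojourn = E residual + (L / f) * (E found + 1)`, where `L` is the mean length of such a cycle and
`f` the scheduling probability of the downlink (`integral_sojourn`). Applied to the cycles in which
the packet is at the head of the queue, the same identity shows that its transmission takes
`tau .downlink` in the mean (`integral_len_serviceCycle`), so that
`E sojourn = E waiting + tau .downlink`. Wald's identity and the Borel-Cantelli lemma also show that
almost surely every packet is served.

Little's law along a sample path (`little_law`) expresses the time average of the number of waiting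
packets as the arrival rate times the mean wait. With the assumption that arriving packets see time
averages, the two expressions for the mean sojourn delay become a linear equation for the mean
wait, which stability makes solvable (`SteadyState.hasMean_sojourn`).
-/

/-! ### Sample paths of a channel -/

theorem Monotone.sum_Ico_tsub {g : ℕ → ℕ} (hg : Monotone g) {m n : ℕ} (hmn : m ≤ n) :
    ∑ i ∈ Finset.Ico m n, (g (i + 1) - g i) = g n - g m := by
  induction n, hmn using Nat.le_induction with
  | base => simp
  | succ n hmn ih =>
    rw [Finset.sum_Ico_succ_top hmn, ih]
    have h1 := hg hmn
    have h2 := hg (Nat.le_succ n)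
    simp only [Nat.succ_eq_add_one] at h2
    omega

namespace ChannelData

/-- The class of the packet actually carried by cycle `m`: the class drawn by the scheduler, except
that a downlink cycle without a waiting downlink packet carries a beacon. -/
def sent {Ω : Type*} (Q : ChannelData Ω) (m : ℕ) (ω : Ω) : TrafficClass :=
  if Q.pick m ω = .downlink ∧ ¬ Q.arr (Q.served m ω) ω ≤ Q.cycleStart m ω then .beacon
  else Q.pick m ω

theorem cycleStart_succ {Ω : Type*} (Q : ChannelData Ω) (m : ℕ) (ω : Ω) :
    Q.cycleStart (m + 1) ω = Q.cycleStart m ω + Q.len (Q.sent m ω) m ω := by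
  obtain h | h | h : Q.pick m ω = .downlink ∨ Q.pick m ω = .uplink ∨ Q.pick m ω = .beacon := by
    cases Q.pick m ω <;> simp
  · by_cases h1 : Q.arr (Q.state m ω).2 ω ≤ (Q.state m ω).1 <;>
      simp [cycleStart, sent, served, state, h, h1]
  all_goals simp [cycleStart, sent, served, state, h]

theorem served_succ {Ω : Type*} (Q : ChannelData Ω) (m : ℕ) (ω : Ω) :
    Q.served (m + 1) ω = Q.served m ω + if Q.sent m ω = .downlink then 1 else 0 := by
  obtain h | h | h : Q.pick m ω = .downlink ∨ Q.pick m ω = .uplink ∨ Q.pick m ω = .beacon := by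
    cases Q.pick m ω <;> simp
  · by_cases h1 : Q.arr (Q.state m ω).2 ω ≤ (Q.state m ω).1 <;>
      simp [cycleStart, sent, served, state, h, h1]
  all_goals simp [cycleStart, sent, served, state, h]

theorem sent_eq_downlink {Ω : Type*} {Q : ChannelData Ω} {m : ℕ} {ω : Ω} :
    Q.sent m ω = .downlink ↔
      Q.pick m ω = .downlink ∧ Q.arr (Q.served m ω) ω ≤ Q.cycleStart m ω := by
  unfold sent
  split_ifs with h
  · simp [h.1, h.2]
  · exact ⟨fun h' => ⟨h', by by_contra h2; exact h ⟨h', h2⟩⟩, fun h' => h'.1⟩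

theorem served_mono {Ω : Type*} (Q : ChannelData Ω) (ω : Ω) :
    Monotone fun m => Q.served m ω :=
  monotone_nat_of_le_succ fun m => by rw [served_succ]; omega

theorem cycleStart_mono {Ω : Type*} (Q : ChannelData Ω) (ω : Ω) :
    Monotone fun m => Q.cycleStart m ω :=
  monotone_nat_of_le_succ fun m => by rw [cycleStart_succ]; omega

theorem le_cycleStart {Ω : Type*} {Q : ChannelData Ω} {ω : Ω}
    (hlen : ∀ c m, 1 ≤ Q.len c m ω) (m : ℕ) : m ≤ Q.cycleStart m ω := by
  induction m with
  | zero => exact Nat.zero_le _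
  | succ m ih =>
    rw [cycleStart_succ]
    have := hlen (Q.sent m ω) m
    omega

/-- The cycles that the `k`-th downlink packet spends in the system: those that start after its
arrival, up to the cycle in which it is transmitted. The event is decided by the history up to the
start of cycle `m`. -/
def present {Ω : Type*} (Q : ChannelData Ω) (k m : ℕ) : Set Ω :=
  {ω | Q.arr k ω ≤ Q.cycleStart m ω ∧ Q.served m ω ≤ k}

/-- While a downlink packet is present, the class drawn by the scheduler is the class sent. -/
theorem sent_eq_pick {Ω : Type*} {Q : ChannelData Ω} {ω : Ω}
    (harr : Monotone fun k => Q.arr k ω) {k m : ℕ} (h : ω ∈ Q.present k m) :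
    Q.sent m ω = Q.pick m ω :=
  if_neg fun h' => h'.2 ((harr h.2).trans h.1)

/-- The first cycle that starts at or after the arrival of the `k`-th downlink packet. -/
noncomputable def firstCycle {Ω : Type*} (Q : ChannelData Ω) (k : ℕ) (ω : Ω) : ℕ :=
  sInf {m | Q.arr k ω ≤ Q.cycleStart m ω}

theorem firstCycle_le_iff {Ω : Type*} {Q : ChannelData Ω} {ω : Ω}
    (hlen : ∀ c m, 1 ≤ Q.len c m ω) {k m : ℕ} :
    Q.firstCycle k ω ≤ m ↔ Q.arr k ω ≤ Q.cycleStart m ω := by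
  refine ⟨fun h => ?_, fun h => Nat.sInf_le h⟩
  have h' : Q.firstCycle k ω ∈ {m | Q.arr k ω ≤ Q.cycleStart m ω} :=
    Nat.sInf_mem ⟨Q.arr k ω, le_cycleStart hlen _⟩
  exact le_trans h' (Q.cycleStart_mono ω h)

/-- The cycle in which `served` passes `k` transmits the `k`-th packet, which has arrived by then. -/
theorem served_of_lt_served_succ {Ω : Type*} {Q : ChannelData Ω} {ω : Ω} {k m : ℕ}
    (h : k < Q.served (m + 1) ω) (h' : Q.served m ω ≤ k) :
    Q.served m ω = k ∧ Q.served (m + 1) ω = k + 1 ∧ Q.sent m ω = .downlink ∧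
      Q.arr k ω ≤ Q.cycleStart m ω := by
  rw [served_succ] at h ⊢
  split_ifs at h ⊢ with hs
  · have hk : Q.served m ω = k := by omega
    exact ⟨hk, by omega, hs, hk ▸ (sent_eq_downlink.1 hs).2⟩
  · omega

theorem serviceCycle_spec {Ω : Type*} {Q : ChannelData Ω} {ω : Ω} {k : ℕ}
    (hk : ∃ m, k < Q.served m ω) :
    k < Q.served (Q.serviceCycle k ω + 1) ω ∧ Q.served (Q.serviceCycle k ω) ω ≤ k := by
  have hne : {m | k < Q.served (m + 1) ω}.Nonempty := by
    obtain ⟨m, hm⟩ := hk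
    exact ⟨m, hm.trans_le (Q.served_mono ω (Nat.le_succ m))⟩
  refine ⟨Nat.sInf_mem hne, ?_⟩
  rcases Nat.eq_zero_or_pos (Q.serviceCycle k ω) with h0 | h0
  · rw [h0]; exact Nat.zero_le _
  · by_contra! h
    have : Q.serviceCycle k ω - 1 ∈ {m | k < Q.served (m + 1) ω} := by
      simpa [Nat.sub_add_cancel h0] using h
    have := Nat.sInf_le this
    change Q.serviceCycle k ω ≤ _ at this
    omega

theorem le_serviceCycle_iff {Ω : Type*} {Q : ChannelData Ω} {ω : Ω} {k m : ℕ}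
    (hk : ∃ m, k < Q.served m ω) : m ≤ Q.serviceCycle k ω ↔ Q.served m ω ≤ k := by
  obtain ⟨h1, h2⟩ := serviceCycle_spec hk
  refine ⟨fun h => (Q.served_mono ω h).trans h2, fun h => ?_⟩
  by_contra! h'
  have h3 := Q.served_mono ω (Nat.succ_le_of_lt h')
  simp only [Nat.succ_eq_add_one] at h3
  omega

theorem mem_present_iff {Ω : Type*} {Q : ChannelData Ω} {ω : Ω}
    (hlen : ∀ c m, 1 ≤ Q.len c m ω) {k m : ℕ} (hk : ∃ m, k < Q.served m ω) :
    ω ∈ Q.present k m ↔ m ∈ Finset.Ico (Q.firstCycle k ω) (Q.serviceCycle k ω + 1) := by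
  rw [Finset.mem_Ico, firstCycle_le_iff hlen, Nat.lt_succ_iff, le_serviceCycle_iff hk]
  rfl

theorem firstCycle_le_serviceCycle {Ω : Type*} {Q : ChannelData Ω} {ω : Ω}
    (hlen : ∀ c m, 1 ≤ Q.len c m ω) {k : ℕ} (hk : ∃ m, k < Q.served m ω) :
    Q.firstCycle k ω ≤ Q.serviceCycle k ω := by
  obtain ⟨h1, h2⟩ := serviceCycle_spec hk
  exact (firstCycle_le_iff hlen).2 (served_of_lt_served_succ h1 h2).2.2.2

theorem arr_le_serviceStart {Ω : Type*} {Q : ChannelData Ω} {ω : Ω} {k : ℕ}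
    (hk : ∃ m, k < Q.served m ω) : Q.arr k ω ≤ Q.serviceStart k ω := by
  obtain ⟨h1, h2⟩ := serviceCycle_spec hk
  exact (served_of_lt_served_succ h1 h2).2.2.2

/-- Residual time plus the total length of the cycles for which a packet is present is its
sojourn delay. -/
theorem sojourn_eq {Ω : Type*} {Q : ChannelData Ω} {ω : Ω}
    (harr : Monotone fun k => Q.arr k ω) (hlen : ∀ c m, 1 ≤ Q.len c m ω) {k : ℕ}
    (hk : ∃ m, k < Q.served m ω) :
    Q.sojourn k ω = Q.residual k ω +
      (∑ m ∈ Finset.Ico (Q.firstCycle k ω) (Q.serviceCycle k ω + 1),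
        Q.len (Q.pick m ω) m ω : ℕ) := by
  obtain ⟨h1, h2⟩ := serviceCycle_spec hk
  have hs := (served_of_lt_served_succ h1 h2).2.2.1
  have hT := Q.cycleStart_succ (Q.serviceCycle k ω) ω
  rw [hs] at hT
  have hsum : ∑ m ∈ Finset.Ico (Q.firstCycle k ω) (Q.serviceCycle k ω + 1),
      Q.len (Q.pick m ω) m ω =
      Q.cycleStart (Q.serviceCycle k ω + 1) ω - Q.cycleStart (Q.firstCycle k ω) ω := by
    rw [← (Q.cycleStart_mono ω).sum_Ico_tsub
      ((firstCycle_le_serviceCycle hlen hk).trans (Nat.le_succ _))]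
    refine Finset.sum_congr rfl fun m hm => ?_
    rw [cycleStart_succ, sent_eq_pick harr ((mem_present_iff hlen hk).2 hm)]
    omega
  have hle := Q.cycleStart_mono ω ((firstCycle_le_serviceCycle hlen hk).trans (Nat.le_succ _))
  simp only [Nat.succ_eq_add_one] at hle
  rw [hsum, Nat.cast_sub hle, sojourn, waiting, residual, serviceStart, hT]
  push_cast
  rw [firstCycle]
  ring

/-- The downlink cycles for which a packet is present serve the packets it found waiting, and
finally the packet itself. -/
theorem found_add_one_eq {Ω : Type*} {Q : ChannelData Ω} {ω : Ω}
    (harr : Monotone fun k => Q.arr k ω) (hlen : ∀ c m, 1 ≤ Q.len c m ω) {k : ℕ}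
    (hk : ∃ m, k < Q.served m ω) :
    Q.found k ω + 1 =
      (∑ m ∈ Finset.Ico (Q.firstCycle k ω) (Q.serviceCycle k ω + 1),
        if Q.pick m ω = .downlink then 1 else 0 : ℕ) := by
  obtain ⟨h1, h2⟩ := serviceCycle_spec hk
  have hMle := firstCycle_le_serviceCycle hlen hk
  have hMk := (le_serviceCycle_iff hk).1 hMle
  have hsum : (∑ m ∈ Finset.Ico (Q.firstCycle k ω) (Q.serviceCycle k ω + 1),
      if Q.pick m ω = .downlink then 1 else 0) = k + 1 - Q.served (Q.firstCycle k ω) ω := by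
    rw [← (served_of_lt_served_succ h1 h2).2.1, ← (Q.served_mono ω).sum_Ico_tsub
      (hMle.trans (Nat.le_succ _))]
    refine Finset.sum_congr rfl fun m hm => ?_
    rw [served_succ, sent_eq_pick harr ((mem_present_iff hlen hk).2 hm)]
    omega
  have hfilter : ((Finset.range k).filter fun j => Q.arr k ω ≤ Q.serviceStart j ω) =
      Finset.Ico (Q.served (Q.firstCycle k ω) ω) k := by
    ext j
    rw [Finset.mem_filter, Finset.mem_range, Finset.mem_Ico, and_comm]
    refine and_congr_left fun hj => ?_
    obtain ⟨m, hm⟩ := hk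
    rw [serviceStart, ← firstCycle_le_iff hlen, le_serviceCycle_iff ⟨m, hj.trans hm⟩]
  rw [hsum, found, hfilter, Nat.card_Ico]
  norm_cast
  omega

/-- A bound that does not presuppose that the `k`-th packet is ever served. -/
theorem sum_present_downlink_le {Ω : Type*} {Q : ChannelData Ω} {ω : Ω}
    (harr : Monotone fun k => Q.arr k ω) (k n : ℕ) :
    ∑ m ∈ Finset.range n, (Q.present k m).indicator
      (fun ω => if Q.pick m ω = .downlink then 1 else 0) ω ≤ min (Q.served n ω) (k + 1) := by
  induction n with
  | zero => simp
  | succ n ih =>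
    rw [Finset.sum_range_succ, served_succ]
    by_cases h : ω ∈ Q.present k n
    · rw [Set.indicator_of_mem h, sent_eq_pick harr h]
      have := h.2
      split_ifs <;> omega
    · rw [Set.indicator_of_notMem h]
      omega

end ChannelData

/-! ### Little's law along a sample path -/

/-- A counting process with a positive rate has only finitely many points in each bounded interval;
as the points are ordered, those before `t` are the first ones. -/
theorem lt_ncard_iff_of_rate {A : ℕ → ℕ} (hA : Monotone A) {a : ℝ} (ha : 0 < a)
    (hrate : Tendsto (fun t : ℕ => ({k | A k < t}.ncard : ℝ) / t) atTop (𝓝 a)) (t k : ℕ) :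
    k < {k | A k < t}.ncard ↔ A k < t := by
  have hex : ∃ p, t ≤ A p := by
    by_contra! h
    -- the set of arrivals is infinite from `t` on, and then `Set.ncard` takes the value `0`
    have : Tendsto (fun t : ℕ => ({k | A k < t}.ncard : ℝ) / t) atTop (𝓝 0) := by
      refine tendsto_const_nhds.congr' ?_
      filter_upwards [eventually_ge_atTop t] with s hs
      have : {k | A k < s} = Set.univ := Set.eq_univ_of_forall fun k => (h k).trans_le hs
      rw [this, Set.infinite_univ.ncard]
      simp
    exact ha.ne' (tendsto_nhds_unique hrate this)
  classical
  have hset : {k | A k < t} = ((Finset.range (Nat.find hex) : Finset ℕ) : Set ℕ) := by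
    ext j
    rw [Finset.coe_range, Set.mem_Iio, Nat.lt_find_iff]
    exact ⟨fun hj m hm => not_le.2 ((hA hm).trans_lt hj), fun h => not_le.1 (h j le_rfl)⟩
  have hcard : {k | A k < t}.ncard = Nat.find hex := by
    rw [hset, Set.ncard_coe_finset, Finset.card_range]
  rw [hcard, ← Finset.mem_range, ← Finset.mem_coe, ← hset]
  rfl

/-- The terms of a sequence whose averages converge grow slower than linearly. -/
theorem exists_le_const_add_mul_of_cesaro {X : ℕ → ℝ} (hX : ∀ k, 0 ≤ X k) {w : ℝ}
    (hw : Tendsto (fun n : ℕ => (∑ k ∈ Finset.range n, X k) / n) atTop (𝓝 w)) {ε : ℝ}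
    (hε : 0 < ε) : ∃ C, ∀ k : ℕ, X k ≤ C + ε * (k + 1) := by
  have h1 : Tendsto (fun n : ℕ => X n / ((n : ℝ) + 1)) atTop (𝓝 0) := by
    have h2 := hw.comp (tendsto_add_atTop_nat 1)
    have h3 := hw.mul (tendsto_natCast_div_add_atTop (1 : ℝ))
    have h4 := h2.sub h3
    simp only [mul_one, sub_self] at h4
    refine h4.congr' ?_
    filter_upwards [eventually_gt_atTop 0] with n hn
    have : (0 : ℝ) < n := by exact_mod_cast hn
    simp only [Function.comp, Finset.sum_range_succ]
    push_cast
    field_simp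
    ring
  obtain ⟨J, hJ⟩ := eventually_atTop.1 (h1.eventually (gt_mem_nhds hε))
  refine ⟨∑ k ∈ Finset.range J, X k, fun k => ?_⟩
  have hS : 0 ≤ ∑ k ∈ Finset.range J, X k := Finset.sum_nonneg fun k _ => hX k
  have hk : (0 : ℝ) < (k : ℝ) + 1 := by positivity
  rcases lt_or_ge k J with h | h
  · have := Finset.single_le_sum (fun k _ => hX k) (Finset.mem_range.2 h)
    nlinarith
  · have := (div_lt_iff₀ hk).1 (hJ k h)
    linarith

/-- Little's law for a sample path on which customer `k` waits from `A k` to `B k`: if the arrival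
rate `a`, the mean wait `w` and the time average `N` of the number of waiting customers exist,
then `N = a * w`. The area under the queue length up to time `t` is at most the total wait of the
customers arriving before `t`, and at least that of the customers served by `t`. As waits grow
slower than linearly, the latter include, for large `s`, all that arrive before `q * s` if
`t = (q + 1) * s`. -/
theorem little_law {A B : ℕ → ℕ} (hA : Monotone A) (hAB : ∀ k, A k ≤ B k) {a w N : ℝ} (ha : 0 < a)
    (hrate : Tendsto (fun t : ℕ => ({k | A k < t}.ncard : ℝ) / t) atTop (𝓝 a))
    (hw : Tendsto (fun n : ℕ => (∑ k ∈ Finset.range n, ((B k : ℝ) - A k)) / n) atTop (𝓝 w))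
    (hN : Tendsto (fun t : ℕ => (∑ s ∈ Finset.range t, ({j | A j ≤ s ∧ s < B j}.ncard : ℝ)) / t)
      atTop (𝓝 N)) : N = a * w := by
  classical
  set n : ℕ → ℕ := fun t => {k | A k < t}.ncard
  have hlt : ∀ t k, k < n t ↔ A k < t := lt_ncard_iff_of_rate hA ha hrate
  have hX : ∀ k, (0 : ℝ) ≤ (B k : ℝ) - A k := fun k => sub_nonneg.2 (by exact_mod_cast hAB k)
  have hXc : ∀ k, ((B k - A k : ℕ) : ℝ) = (B k : ℝ) - A k := fun k => Nat.cast_sub (hAB k)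
  have hnmono : ∀ u t, u ≤ t → n u ≤ n t := fun u t hut => by
    by_contra! h
    have := (hlt u (n t)).1 h
    exact lt_irrefl _ ((hlt t (n t)).2 (this.trans_le hut))
  -- the area under the queue length, counted customer by customer
  have hsum : ∀ t, (∑ s ∈ Finset.range t, ({j | A j ≤ s ∧ s < B j}.ncard : ℝ)) =
      ((∑ j ∈ Finset.range (n t),
        ((Finset.range t).filter fun s => A j ≤ s ∧ s < B j).card : ℕ) : ℝ) := by
    intro t
    have h1 : ∀ s ∈ Finset.range t, {j | A j ≤ s ∧ s < B j}.ncard =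
        ((Finset.range (n t)).filter fun j => A j ≤ s ∧ s < B j).card := by
      intro s hs
      rw [← Set.ncard_coe_finset]
      congr 1
      ext j
      simp only [Set.mem_ofPred_eq, Finset.coe_filter, Finset.mem_range, hlt]
      have := Finset.mem_range.1 hs
      exact ⟨fun h => ⟨by omega, h⟩, fun h => h.2⟩
    rw [← Nat.cast_sum, Finset.sum_congr rfl h1]
    congr 1
    exact Finset.sum_card_bipartiteAbove_eq_sum_card_bipartiteBelow
      (fun s j => A j ≤ s ∧ s < B j)
  have hup : ∀ t, (∑ s ∈ Finset.range t, ({j | A j ≤ s ∧ s < B j}.ncard : ℝ)) ≤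
      ∑ j ∈ Finset.range (n t), ((B j : ℝ) - A j) := by
    intro t
    rw [hsum, Nat.cast_sum]
    refine Finset.sum_le_sum fun j _ => ?_
    rw [← hXc, ← Nat.card_Ico]
    exact_mod_cast Finset.card_le_card fun s hs => by
      simpa using (Finset.mem_filter.1 hs).2
  have hlow : ∀ u t, u ≤ t → (∀ j < n u, B j ≤ t) →
      ∑ j ∈ Finset.range (n u), ((B j : ℝ) - A j) ≤
      (∑ s ∈ Finset.range t, ({j | A j ≤ s ∧ s < B j}.ncard : ℝ)) := by
    intro u t hut hB
    rw [hsum, Nat.cast_sum]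
    refine le_trans (Finset.sum_le_sum fun j hj => ?_)
      (Finset.sum_le_sum_of_subset_of_nonneg (Finset.range_mono (hnmono u t hut))
        fun _ _ _ => Nat.cast_nonneg _)
    rw [← hXc, ← Nat.card_Ico]
    have := hB j (Finset.mem_range.1 hj)
    exact_mod_cast Finset.card_le_card fun s hs => by
      rw [Finset.mem_Ico] at hs
      exact Finset.mem_filter.2 ⟨Finset.mem_range.2 (by omega), hs⟩
  have hntop : Tendsto n atTop atTop :=
    tendsto_atTop_atTop.2 fun b => ⟨A b + 1, fun t ht => ((hlt t b).2 (by omega)).le⟩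
  have hF : Tendsto (fun t : ℕ => (∑ j ∈ Finset.range (n t), ((B j : ℝ) - A j)) / t) atTop
      (𝓝 (a * w)) := by
    refine (hrate.mul (hw.comp hntop)).congr' ?_
    filter_upwards [hntop.eventually_gt_atTop 0] with t ht
    have : (0 : ℝ) < n t := by exact_mod_cast ht
    change (n t : ℝ) / t * ((∑ j ∈ Finset.range (n t), ((B j : ℝ) - A j)) / n t) = _
    field_simp
  refine le_antisymm (le_of_tendsto_of_tendsto' hN hF fun t => by gcongr; exact hup t) ?_
  have hq : ∀ q : ℕ, 0 < q → a * w * ((q : ℝ) / (q + 1)) ≤ N := by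
    intro q hq0
    have hq' : (0 : ℝ) < q := by exact_mod_cast hq0
    -- this `ε` bounds the waits of the about `a * q * s` customers arriving before `q * s` by `s`
    obtain ⟨C, hC⟩ := exists_le_const_add_mul_of_cesaro hX hw
      (ε := 1 / (2 * (a + 1) * q)) (by positivity)
    have ht1 : Tendsto (fun s : ℕ => q * s) atTop atTop :=
      tendsto_id.const_mul_atTop' hq0
    have ht2 : Tendsto (fun s : ℕ => (q + 1) * s) atTop atTop :=
      tendsto_id.const_mul_atTop' (Nat.succ_pos q)
    have hl := (hF.comp ht1).mul_const ((q : ℝ) / (q + 1))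
    refine le_of_tendsto_of_tendsto hl (hN.comp ht2) ?_
    have hr := (hrate.comp ht1).eventually (gt_mem_nhds (show a < a + 1 by linarith))
    obtain ⟨K, hK⟩ := exists_nat_ge (2 * C)
    filter_upwards [hr, eventually_ge_atTop K, eventually_gt_atTop 0] with s hs hsK hs0
    have hs0' : (0 : ℝ) < s := by exact_mod_cast hs0
    have hsK' : (K : ℝ) ≤ s := by exact_mod_cast hsK
    have hle : (∑ j ∈ Finset.range (n (q * s)), ((B j : ℝ) - A j)) ≤
        (∑ s ∈ Finset.range ((q + 1) * s), ({j | A j ≤ s ∧ s < B j}.ncard : ℝ)) := by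
      refine hlow _ _ (by gcongr; omega) fun j hj => ?_
      have h1 := (hlt _ _).1 hj
      have h2 := hC j
      have h3 : ((j : ℝ) + 1) ≤ n (q * s) := by exact_mod_cast hj
      have h4 : (n (q * s) : ℝ) ≤ (a + 1) * (q * s) := by
        have := (div_lt_iff₀ (by push_cast; positivity)).1 hs
        push_cast at this
        exact this.le
      have h5 : 1 / (2 * (a + 1) * q) * ((j : ℝ) + 1) ≤ s / 2 := by
        calc 1 / (2 * (a + 1) * q) * ((j : ℝ) + 1)
            ≤ 1 / (2 * (a + 1) * q) * ((a + 1) * (q * s)) := by gcongr; exact h3.trans h4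
          _ = s / 2 := by field_simp
      have h6 : (B j : ℝ) ≤ A j + s := by linarith
      have h7 : B j ≤ A j + s := by exact_mod_cast h6
      rw [add_mul, one_mul]
      omega
    simp only [Function.comp]
    push_cast
    rw [show ∀ x : ℝ, x / ((q : ℝ) * s) * (q / (q + 1)) = x / ((q + 1) * s) from fun x => by
      field_simp]
    gcongr
  have hlim : Tendsto (fun q : ℕ => a * w * ((q : ℝ) / (q + 1))) atTop (𝓝 (a * w * 1)) :=
    (tendsto_natCast_div_add_atTop (1 : ℝ)).const_mul _
  rw [mul_one] at hlim
  exact le_of_tendsto hlim (by filter_upwards [eventually_gt_atTop 0] with q hq0 using hq q hq0)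

/-! ### Measurability with respect to the history -/

instance : DiscreteMeasurableSpace TrafficClass := ⟨fun _ => trivial⟩

instance : Fintype TrafficClass where
  elems := {.downlink, .uplink, .beacon}
  complete c := by cases c <;> simp

theorem TrafficClass.sum_univ {M : Type*} [AddCommMonoid M] (g : TrafficClass → M) :
    ∑ c, g c = g .downlink + (g .uplink + g .beacon) := by
  have : (Finset.univ : Finset TrafficClass) = {.downlink, .uplink, .beacon} := rfl
  rw [this, Finset.sum_insert (by simp), Finset.sum_insert (by simp), Finset.sum_singleton]

namespace DownlinkChannel

variable {Ω : Type*} [mΩ : MeasurableSpace Ω] {μ : Measure Ω}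

theorem measurableSet_arr_served_le (Q : DownlinkChannel μ) {m : ℕ}
    (h : Measurable[Q.hist m] (Q.served m)) :
    MeasurableSet[Q.hist m] {ω | Q.arr (Q.served m ω) ω ≤ Q.cycleStart m ω} := by
  have : {ω | Q.arr (Q.served m ω) ω ≤ Q.cycleStart m ω} =
      ⋃ k, (Q.served m ⁻¹' {k} ∩ {ω | Q.arr k ω ≤ Q.cycleStart m ω}) := by
    ext ω
    simp
  rw [this]
  exact MeasurableSet.iUnion fun k => (h (measurableSet_singleton k)).inter (Q.arr_hist k m)

theorem measurable_state (Q : DownlinkChannel μ) (m : ℕ) :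
    Measurable[Q.hist m] (Q.cycleStart m) ∧ Measurable[Q.hist m] (Q.served m) := by
  induction m with
  | zero => exact ⟨measurable_const, measurable_const⟩
  | succ m ih =>
    have hle := Q.hist.mono (Nat.le_succ m)
    have hsent : Measurable[Q.hist (m + 1)] (Q.sent m) := by
      refine Measurable.ite ?_ measurable_const (Q.pick_hist m)
      exact (Q.pick_hist m (measurableSet_singleton TrafficClass.downlink)).inter
        (hle _ (Q.measurableSet_arr_served_le ih.2)).compl
    have hlen : Measurable[Q.hist (m + 1)] fun ω => Q.len (Q.sent m ω) m ω :=
      (measurable_from_prod_countable_right (f := fun p : TrafficClass × Ω => Q.len p.1 m p.2)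
        fun c => Q.len_hist c m).comp (hsent.prodMk measurable_id)
    have hT := (ih.1.mono hle le_rfl).add hlen
    have hS := (ih.2.mono hle le_rfl).add
      ((Measurable.of_discrete (f := fun c : TrafficClass => if c = .downlink then 1 else 0)).comp
        hsent)
    exact ⟨by convert hT using 1; ext ω; exact Q.cycleStart_succ m ω,
      by convert hS using 1; ext ω; exact Q.served_succ m ω⟩

theorem measurableSet_present (Q : DownlinkChannel μ) (k m : ℕ) :
    MeasurableSet[Q.hist m] (Q.present k m) :=
  (Q.arr_hist k m).inter ((Q.measurable_state m).2 (Set.to_countable (Set.Iic k)).measurableSet)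

/-! ### Sums of draws over a random set of cycles -/

/-- Everything that is drawn for cycle `m`: the class, and a length for each class. -/
def draw (Q : DownlinkChannel μ) (m : ℕ) (ω : Ω) : TrafficClass × (TrafficClass → ℕ) :=
  (Q.pick m ω, fun c => Q.len c m ω)

theorem measurable_draw (Q : DownlinkChannel μ) (m : ℕ) : Measurable (Q.draw m) :=
  ((Q.pick_hist m).mono (Q.hist.le _) le_rfl).prodMk
    (measurable_pi_lambda _ fun c => (Q.len_hist c m).mono (Q.hist.le _) le_rfl)

theorem hasSum_present (Q : DownlinkChannel μ) {ω : Ω} {k : ℕ} (hk : ∃ m, k < Q.served m ω)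
    (φ : TrafficClass × (TrafficClass → ℕ) → ℝ) :
    HasSum (fun m => (Q.present k m).indicator (fun ω => φ (Q.draw m ω)) ω)
      (∑ m ∈ Finset.Ico (Q.firstCycle k ω) (Q.serviceCycle k ω + 1), φ (Q.draw m ω)) := by
  have hmem : ∀ m, ω ∈ Q.present k m ↔ _ := fun m =>
    ChannelData.mem_present_iff (fun c m => Q.len_pos c m ω) hk
  rw [Finset.sum_congr rfl fun m hm => (Set.indicator_of_mem ((hmem m).2 hm)
    (fun ω => φ (Q.draw m ω))).symm]
  exact hasSum_sum_of_ne_finset_zero fun m hm =>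
    Set.indicator_of_notMem (fun h => hm ((hmem m).1 h)) _

/-- Wald's identity, for cycles `m` selected by events `H m` that are decided before cycle `m`. -/
theorem lintegral_tsum_indicator_draw (Q : DownlinkChannel μ) {H : ℕ → Set Ω}
    (hH : ∀ m, MeasurableSet[Q.hist m] (H m)) (φ : TrafficClass × (TrafficClass → ℕ) → ENNReal)
    {x : ENNReal} (hx : ∀ m, ∫⁻ ω, φ (Q.draw m ω) ∂μ = x) :
    ∫⁻ ω, ∑' m, (H m).indicator (fun ω => φ (Q.draw m ω)) ω ∂μ = (∑' m, μ (H m)) * x := by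
  have hφ : Measurable φ := Measurable.of_discrete
  have hH' : ∀ m, MeasurableSet (H m) := fun m => Q.hist.le m _ (hH m)
  have hmeas : ∀ m, Measurable ((H m).indicator fun ω => φ (Q.draw m ω)) := fun m =>
    (hφ.comp (Q.measurable_draw m)).indicator (hH' m)
  rw [lintegral_tsum fun m => (hmeas m).aemeasurable, ← ENNReal.tsum_mul_right]
  refine tsum_congr fun m => ?_
  have hind := lintegral_mul_eq_lintegral_mul_lintegral_of_independent_measurableSpace
    (Q.hist.le m) (Q.measurable_draw m).comap_le (Q.indep_hist m).symm
    (f := (H m).indicator 1) (g := fun ω => φ (Q.draw m ω))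
    ((@measurable_const _ _ _ (Q.hist m) 1).indicator (hH m)) (hφ.comp (comap_measurable _))
  rw [hx, lintegral_indicator_one (hH' m)] at hind
  rw [← hind]
  refine lintegral_congr fun ω => ?_
  by_cases h : ω ∈ H m <;> simp [h]

/-- Wald's identity for real-valued sums. -/
theorem integral_of_hasSum_indicator_draw (Q : DownlinkChannel μ) {H : ℕ → Set Ω}
    (hH : ∀ m, MeasurableSet[Q.hist m] (H m)) (hfin : ∑' m, μ (H m) ≠ ⊤)
    {φ : TrafficClass × (TrafficClass → ℕ) → ℝ} (hφ : ∀ p, 0 ≤ φ p)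
    (hint : ∀ m, Integrable (fun ω => φ (Q.draw m ω)) μ)
    {x : ℝ} (hx : ∀ m, ∫ ω, φ (Q.draw m ω) ∂μ = x) {g : Ω → ℝ}
    (hg : ∀ᵐ ω ∂μ, HasSum (fun m => (H m).indicator (fun ω => φ (Q.draw m ω)) ω) (g ω)) :
    Integrable g μ ∧ ∫ ω, g ω ∂μ = (∑' m, μ (H m)).toReal * x := by
  have hx0 : 0 ≤ x := hx 0 ▸ integral_nonneg fun ω => hφ _
  have hW := Q.lintegral_tsum_indicator_draw hH (fun p => ENNReal.ofReal (φ p))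
    (x := ENNReal.ofReal x) fun m => by
      rw [← hx m, ofReal_integral_eq_lintegral_ofReal (hint m) (ae_of_all _ fun ω => hφ _)]
  have hmeas : Measurable fun ω =>
      ∑' m, (H m).indicator (fun ω => ENNReal.ofReal (φ (Q.draw m ω))) ω :=
    Measurable.tsum fun m =>
      ((Measurable.of_discrete (f := fun p => ENNReal.ofReal (φ p))).comp
        (Q.measurable_draw m)).indicator (Q.hist.le m _ (hH m))
  have hne : ∫⁻ ω, ∑' m, (H m).indicator (fun ω => ENNReal.ofReal (φ (Q.draw m ω))) ω ∂μ ≠ ⊤ := by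
    rw [hW]
    exact ENNReal.mul_ne_top hfin ENNReal.ofReal_ne_top
  have hae : g =ᵐ[μ] fun ω =>
      (∑' m, (H m).indicator (fun ω => ENNReal.ofReal (φ (Q.draw m ω))) ω).toReal := by
    filter_upwards [hg] with ω hω
    have h0 : ∀ m, 0 ≤ (H m).indicator (fun ω => φ (Q.draw m ω)) ω := fun m =>
      Set.indicator_nonneg (fun _ _ => hφ _) _
    have h1 : ∀ m, (H m).indicator (fun ω => ENNReal.ofReal (φ (Q.draw m ω))) ω =
        ENNReal.ofReal ((H m).indicator (fun ω => φ (Q.draw m ω)) ω) := fun m => by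
      by_cases h : ω ∈ H m <;> simp [h]
    simp_rw [h1]
    rw [← ENNReal.ofReal_tsum_of_nonneg h0 hω.summable, hω.tsum_eq,
      ENNReal.toReal_ofReal (hω.nonneg h0)]
  refine ⟨(integrable_toReal_of_lintegral_ne_top hmeas.aemeasurable hne).congr hae.symm, ?_⟩
  rw [integral_congr_ae hae, integral_toReal hmeas.aemeasurable (ae_lt_top hmeas hne), hW,
    ENNReal.toReal_mul, ENNReal.toReal_ofReal hx0]

theorem f_nonneg (Q : DownlinkChannel μ) (c : TrafficClass) : 0 ≤ Q.f c :=
  Q.prob_pick c 0 ▸ measureReal_nonneg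

theorem measurableSet_pick_eq (Q : DownlinkChannel μ) (c : TrafficClass) (m : ℕ) :
    MeasurableSet {ω | Q.pick m ω = c} :=
  (Q.pick_hist m).mono (Q.hist.le _) le_rfl (measurableSet_singleton c)

/-- The expected length of a cycle of class `c`, restricted to the event that `c` is drawn. -/
theorem integral_pick_mul_len (Q : DownlinkChannel μ) (c : TrafficClass) (m : ℕ) :
    Integrable (fun ω => if Q.pick m ω = c then (Q.len c m ω : ℝ) else 0) μ ∧
      ∫ ω, (if Q.pick m ω = c then (Q.len c m ω : ℝ) else 0) ∂μ = Q.f c * Q.tau c := by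
  have h1 : (fun ω => if Q.pick m ω = c then (Q.len c m ω : ℝ) else 0) =
      {ω | Q.pick m ω = c}.indicator fun ω => (Q.len c m ω : ℝ) := by
    ext ω
    by_cases h : Q.pick m ω = c <;> simp [h]
  refine ⟨h1 ▸ (Q.len_integrable c m).indicator (Q.measurableSet_pick_eq c m), ?_⟩
  have hind : IndepFun (fun ω => if Q.pick m ω = c then (1 : ℝ) else 0)
      (fun ω => (Q.len c m ω : ℝ)) μ :=
    (Q.indep_pick_len m).comp (φ := fun b => if b = c then (1 : ℝ) else 0)
      (ψ := fun l : TrafficClass → ℕ => (l c : ℝ)) Measurable.of_discrete Measurable.of_discrete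
  have hmul := hind.integral_fun_mul_eq_mul_integral
    (Measurable.ite (Q.measurableSet_pick_eq c m) measurable_const
      measurable_const).aestronglyMeasurable
    (Q.len_integrable c m).aestronglyMeasurable
  have h2 : ∫ ω, (if Q.pick m ω = c then (1 : ℝ) else 0) ∂μ = Q.f c := by
    rw [← Q.prob_pick c m, ← integral_indicator_one (Q.measurableSet_pick_eq c m)]
    refine integral_congr_ae (ae_of_all _ fun ω => ?_)
    by_cases h : Q.pick m ω = c <;> simp [h]
  rw [Q.mean_len, h2] at hmul
  rw [← hmul]
  refine integral_congr_ae (ae_of_all _ fun ω => ?_)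
  by_cases h : Q.pick m ω = c <;> simp [h]

/-- The expected length of a cycle at whose start a downlink packet is waiting. -/
noncomputable def meanCycle (Q : DownlinkChannel μ) : ℝ :=
  ∑ c, Q.f c * Q.tau c

theorem integral_len_pick (Q : DownlinkChannel μ) (m : ℕ) :
    Integrable (fun ω => (Q.len (Q.pick m ω) m ω : ℝ)) μ ∧
      ∫ ω, (Q.len (Q.pick m ω) m ω : ℝ) ∂μ = Q.meanCycle := by
  have h : (fun ω => (Q.len (Q.pick m ω) m ω : ℝ)) =
      fun ω => ∑ c, if Q.pick m ω = c then (Q.len c m ω : ℝ) else 0 := by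
    ext ω
    simp
  rw [h]
  refine ⟨integrable_finsetSum _ fun c _ => (Q.integral_pick_mul_len c m).1, ?_⟩
  rw [integral_finsetSum _ fun c _ => (Q.integral_pick_mul_len c m).1]
  exact Finset.sum_congr rfl fun c _ => (Q.integral_pick_mul_len c m).2

variable [IsProbabilityMeasure μ]

theorem sum_f (Q : DownlinkChannel μ) : Q.f .downlink + (Q.f .uplink + Q.f .beacon) = 1 := by
  have hm := (Q.pick_hist 0).mono (Q.hist.le _) le_rfl
  have := Measure.isProbabilityMeasure_map (μ := μ) hm.aemeasurable
  have h := sum_measureReal_singleton (μ := μ.map (Q.pick 0)) Finset.univ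
  rw [TrafficClass.sum_univ] at h
  have h1 : ∀ c, (μ.map (Q.pick 0)).real {c} = Q.f c := fun c => by
    rw [map_measureReal_apply hm (measurableSet_singleton c), ← Q.prob_pick c 0]
    rfl
  rw [h1, h1, h1, Finset.coe_univ, probReal_univ] at h
  exact h

theorem integral_pick_downlink (Q : DownlinkChannel μ) (m : ℕ) :
    Integrable (fun ω => if Q.pick m ω = .downlink then (1 : ℝ) else 0) μ ∧
      ∫ ω, (if Q.pick m ω = .downlink then (1 : ℝ) else 0) ∂μ = Q.f .downlink := by
  have h : (fun ω => if Q.pick m ω = .downlink then (1 : ℝ) else 0) =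
      {ω | Q.pick m ω = .downlink}.indicator 1 := by
    ext ω
    by_cases h : Q.pick m ω = .downlink <;> simp [h]
  rw [h, integral_indicator_one (Q.measurableSet_pick_eq _ m), Q.prob_pick]
  exact ⟨(integrable_const (1 : ℝ)).indicator (Q.measurableSet_pick_eq _ m), rfl⟩

/-! ### Every packet is served, and its mean sojourn delay -/

/-- The expected number of cycles for which a packet is present is finite, as at most `k + 1` of
them are downlink cycles. -/
theorem tsum_measure_present_ne_top (Q : DownlinkChannel μ) (hf : 0 < Q.f .downlink) (k : ℕ) :
    ∑' m, μ (Q.present k m) ≠ ⊤ := by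
  have hW := Q.lintegral_tsum_indicator_draw (Q.measurableSet_present k)
    (fun p => if p.1 = .downlink then 1 else 0) (x := ENNReal.ofReal (Q.f .downlink)) fun m => by
      rw [← (Q.integral_pick_downlink m).2,
        ofReal_integral_eq_lintegral_ofReal (Q.integral_pick_downlink m).1
          (ae_of_all _ fun ω => by dsimp only [Pi.zero_apply]; split_ifs <;> norm_num)]
      refine lintegral_congr fun ω => ?_
      by_cases h : Q.pick m ω = .downlink <;> simp [draw, h]
  have hle : ∀ ω, ∑' m, (Q.present k m).indicator
      (fun ω => if (Q.draw m ω).1 = .downlink then (1 : ENNReal) else 0) ω ≤ (k + 1 : ℕ) := by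
    intro ω
    rw [ENNReal.tsum_eq_iSup_nat]
    refine iSup_le fun n => ?_
    have h := (ChannelData.sum_present_downlink_le (Q := Q.toChannelData) (Q.arr_mono ω) k n).trans
      (min_le_right _ _)
    refine le_trans (le_of_eq ?_) (Nat.cast_le.2 h)
    rw [Nat.cast_sum]
    refine Finset.sum_congr rfl fun m _ => ?_
    by_cases h : ω ∈ Q.present k m <;> by_cases h' : Q.pick m ω = .downlink <;> simp [draw, h, h']
  intro htop
  rw [htop, ENNReal.top_mul (by simpa using hf)] at hW
  have := lintegral_mono (μ := μ) hle
  rw [hW, lintegral_const, measure_univ, mul_one] at this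
  exact ENNReal.natCast_ne_top _ (top_le_iff.1 this)

/-- The easy half of the Borel-Cantelli lemma: almost surely, a packet is present for finitely many
cycles only. -/
theorem ae_exists_lt_served (Q : DownlinkChannel μ) (hf : 0 < Q.f .downlink) :
    ∀ᵐ ω ∂μ, ∀ k, ∃ m, k < Q.served m ω := by
  refine ae_all_iff.2 fun k => ?_
  filter_upwards [ae_eventually_notMem (Q.tsum_measure_present_ne_top hf k)] with ω hω
  obtain ⟨m, hm, hm'⟩ := (hω.and (eventually_ge_atTop (Q.arr k ω))).exists
  refine ⟨m, not_le.1 fun h => hm ⟨?_, h⟩⟩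
  exact hm'.trans (ChannelData.le_cycleStart (fun c m => Q.len_pos c m ω) m)

/-- A packet that finds `n` others waiting is present for `n + 1` downlink cycles, hence for
`(n + 1) / f` cycles in the mean, where `f` is the scheduling probability of the downlink. -/
theorem integral_sojourn (Q : DownlinkChannel μ) (hf : 0 < Q.f .downlink) {k : ℕ}
    (hr : Integrable (Q.residual k) μ) (hn : Integrable (Q.found k) μ) :
    Integrable (Q.sojourn k) μ ∧
      ∫ ω, Q.sojourn k ω ∂μ = ∫ ω, Q.residual k ω ∂μ +
        Q.meanCycle / Q.f .downlink * (∫ ω, Q.found k ω ∂μ + 1) := by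
  have hserved : ∀ᵐ ω ∂μ, ∃ m, k < Q.served m ω :=
    (Q.ae_exists_lt_served hf).mono fun ω h => h k
  have hfin := Q.tsum_measure_present_ne_top hf k
  obtain ⟨-, h1⟩ := Q.integral_of_hasSum_indicator_draw (Q.measurableSet_present k) hfin
    (φ := fun p => if p.1 = .downlink then 1 else 0)
    (fun p => by split_ifs <;> norm_num)
    (fun m => (Q.integral_pick_downlink m).1) (fun m => (Q.integral_pick_downlink m).2)
    (g := fun ω => Q.found k ω + 1) (by
      filter_upwards [hserved] with ω hω
      have h := Q.hasSum_present hω fun p => if p.1 = .downlink then 1 else 0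
      rw [ChannelData.found_add_one_eq (Q.arr_mono ω) (fun c m => Q.len_pos c m ω) hω]
      push_cast
      exact h)
  obtain ⟨h2, h3⟩ := Q.integral_of_hasSum_indicator_draw (Q.measurableSet_present k) hfin
    (φ := fun p => (p.2 p.1 : ℝ)) (fun p => Nat.cast_nonneg _)
    (fun m => (Q.integral_len_pick m).1) (fun m => (Q.integral_len_pick m).2)
    (g := fun ω => Q.sojourn k ω - Q.residual k ω) (by
      filter_upwards [hserved] with ω hω
      have h := Q.hasSum_present hω fun p => (p.2 p.1 : ℝ)
      rw [ChannelData.sojourn_eq (Q.arr_mono ω) (fun c m => Q.len_pos c m ω) hω,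
        add_sub_cancel_left]
      push_cast
      exact h)
  have hsoj : Integrable (Q.sojourn k) μ :=
    (h2.add hr).congr (ae_of_all _ fun ω => sub_add_cancel _ _)
  refine ⟨hsoj, ?_⟩
  rw [integral_add hn (integrable_const _), integral_const, probReal_univ, one_smul] at h1
  rw [integral_sub hsoj hr] at h3
  rw [h1]
  field_simp
  linarith

/-- The transmission of a downlink packet takes a downlink service time in the mean: the cycle in
which it happens is the only downlink cycle among those in which the packet heads the queue. -/
theorem integral_len_serviceCycle (Q : DownlinkChannel μ) (hf : 0 < Q.f .downlink) (k : ℕ) :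
    Integrable (fun ω => (Q.len .downlink (Q.serviceCycle k ω) ω : ℝ)) μ ∧
      ∫ ω, (Q.len .downlink (Q.serviceCycle k ω) ω : ℝ) ∂μ = Q.tau .downlink := by
  set H : ℕ → Set Ω := fun m => Q.present k m ∩ {ω | Q.served m ω = k}
  have hH : ∀ m, MeasurableSet[Q.hist m] (H m) := fun m =>
    (Q.measurableSet_present k m).inter ((Q.measurable_state m).2 (measurableSet_singleton k))
  have hfin : ∑' m, μ (H m) ≠ ⊤ := ne_top_of_le_ne_top (Q.tsum_measure_present_ne_top hf k)
    (ENNReal.tsum_le_tsum fun m => measure_mono Set.inter_subset_left)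
  have hsum : ∀ φ : TrafficClass × (TrafficClass → ℕ) → ℝ, (∀ p, p.1 ≠ .downlink → φ p = 0) →
      ∀ᵐ ω ∂μ, HasSum (fun m => (H m).indicator (fun ω => φ (Q.draw m ω)) ω)
        (φ (.downlink, fun c => Q.len c (Q.serviceCycle k ω) ω)) := by
    intro φ hφ
    filter_upwards [Q.ae_exists_lt_served hf] with ω hω
    obtain ⟨h1, h2⟩ := ChannelData.serviceCycle_spec (hω k)
    obtain ⟨h3, h4, h5, h6⟩ := ChannelData.served_of_lt_served_succ h1 h2
    have hmem : ω ∈ H (Q.serviceCycle k ω) := ⟨⟨h6, h2⟩, h3⟩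
    have hval : (H (Q.serviceCycle k ω)).indicator
        (fun ω' => φ (Q.draw (Q.serviceCycle k ω) ω')) ω =
        φ (.downlink, fun c => Q.len c (Q.serviceCycle k ω) ω) := by
      rw [Set.indicator_of_mem hmem, draw, (ChannelData.sent_eq_downlink.1 h5).1]
    rw [← hval]
    refine hasSum_single (f := fun m => (H m).indicator (fun ω => φ (Q.draw m ω)) ω)
      (Q.serviceCycle k ω) fun m hm => ?_
    · by_cases hmH : ω ∈ H m
      · rw [Set.indicator_of_mem hmH]
        refine hφ _ fun hpick => hm (le_antisymm ?_ ?_)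
        · exact (ChannelData.le_serviceCycle_iff (hω k)).2 hmH.1.2
        · refine Nat.sInf_le ?_
          have hs : Q.sent m ω = .downlink :=
            (ChannelData.sent_eq_pick (Q.arr_mono ω) hmH.1).trans hpick
          have hk : Q.served m ω = k := hmH.2
          change k < Q.served (m + 1) ω
          rw [ChannelData.served_succ, if_pos hs, hk]
          exact Nat.lt_succ_self k
      · exact Set.indicator_of_notMem hmH _
  obtain ⟨-, h1⟩ := Q.integral_of_hasSum_indicator_draw hH hfin
    (φ := fun p => if p.1 = .downlink then 1 else 0)
    (fun p => by split_ifs <;> norm_num)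
    (fun m => (Q.integral_pick_downlink m).1) (fun m => (Q.integral_pick_downlink m).2)
    (g := fun _ => 1) (hsum (fun p => if p.1 = .downlink then 1 else 0) fun p hp => if_neg hp)
  obtain ⟨h2, h3⟩ := Q.integral_of_hasSum_indicator_draw hH hfin
    (φ := fun p => if p.1 = .downlink then (p.2 .downlink : ℝ) else 0)
    (fun p => by split_ifs <;> positivity)
    (fun m => (Q.integral_pick_mul_len .downlink m).1)
    (fun m => (Q.integral_pick_mul_len .downlink m).2)
    (g := fun ω => (Q.len .downlink (Q.serviceCycle k ω) ω : ℝ))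
    (hsum (fun p => if p.1 = .downlink then (p.2 .downlink : ℝ) else 0) fun p hp => if_neg hp)
  refine ⟨h2, ?_⟩
  rw [integral_const, probReal_univ, one_smul] at h1
  rw [h3, ← mul_assoc, ← h1, one_mul]

/-! ### The mean sojourn delay in steady state -/

theorem SteadyState.eq_rate_mul {Q : DownlinkChannel μ} {a R w N : ℝ} (h : Q.SteadyState a R)
    (hf : 0 < Q.f .downlink) (hw : HasPathMean μ Q.waiting w)
    (hN : HasPathMean μ Q.queueLength N) : N = a * w := by
  obtain ⟨ω, hrate, hserved, hw, hN⟩ :=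
    (h.rate.and ((Q.ae_exists_lt_served hf).and (hw.and hN))).exists
  exact little_law (A := fun k => Q.arr k ω) (B := fun k => Q.serviceStart k ω) (Q.arr_mono ω)
    (fun k => ChannelData.arr_le_serviceStart (hserved k)) h.rate_pos hrate hw hN

/-- The mean sojourn delay at one hop, in terms of the mean cycle length. -/
theorem SteadyState.hasMean_sojourn {Q : DownlinkChannel μ} {a R : ℝ} (h : Q.SteadyState a R)
    (hf : 0 < Q.f .downlink) (hstab : a * (Q.meanCycle / Q.f .downlink) < 1) :
    HasMean μ Q.sojourn
      ((R + (Q.meanCycle / Q.f .downlink - Q.tau .downlink)) /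
        (1 - a * (Q.meanCycle / Q.f .downlink)) + Q.tau .downlink) := by
  obtain ⟨w, hw, hwp⟩ := h.mean_waiting
  obtain ⟨N, hN, hNp⟩ := h.sees_time_averages
  have hR := h.mean_residual
  have hlittle := h.eq_rate_mul hf hwp hNp
  set lam := Q.meanCycle / Q.f .downlink with hlam
  have hsoj := fun k => Q.integral_sojourn hf (hR.1 k) (hN.1 k)
  have hone : Tendsto (fun n : ℕ => (n : ℝ) / n) atTop (𝓝 1) :=
    tendsto_const_nhds.congr' (by
      filter_upwards [eventually_gt_atTop 0] with n hn
      rw [div_self (by positivity)])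
  have hviaFound : Tendsto (fun n : ℕ => (∑ k ∈ Finset.range n, ∫ ω, Q.sojourn k ω ∂μ) / n) atTop
      (𝓝 (R + lam * (N + 1))) := by
    refine (hR.2.add ((hN.2.add hone).const_mul lam)).congr fun n => ?_
    simp_rw [(hsoj _).2]
    rw [Finset.sum_add_distrib, ← Finset.mul_sum, Finset.sum_add_distrib]
    simp
    ring
  have hviaWaiting : Tendsto (fun n : ℕ => (∑ k ∈ Finset.range n, ∫ ω, Q.sojourn k ω ∂μ) / n) atTop
      (𝓝 (w + Q.tau .downlink)) := by
    have := hw.2.add (hone.const_mul (Q.tau .downlink))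
    rw [mul_one] at this
    refine this.congr fun n => ?_
    have hk : ∀ k, ∫ ω, Q.sojourn k ω ∂μ = ∫ ω, Q.waiting k ω ∂μ + Q.tau .downlink := fun k => by
      rw [← (Q.integral_len_serviceCycle hf k).2,
        ← integral_add (hw.1 k) (Q.integral_len_serviceCycle hf k).1]
      rfl
    simp_rw [hk]
    rw [Finset.sum_add_distrib]
    simp
    ring
  have heq := tendsto_nhds_unique hviaFound hviaWaiting
  have hden : 1 - a * lam ≠ 0 := by linarith
  refine ⟨fun k => (hsoj k).1, ?_⟩
  convert hviaWaiting using 2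
  rw [add_left_inj, div_eq_iff hden]
  rw [hlittle] at heq
  linarith

/-- The mean cycle length per downlink cycle is the downlink service time plus the mean time spent
on other classes before a downlink cycle. -/
theorem meanCycle_div (Q : DownlinkChannel μ) (hf : 0 < Q.f .downlink) :
    Q.meanCycle / Q.f .downlink =
      Q.tau .downlink + (1 - Q.f .downlink) / Q.f .downlink * Q.tauBU := by
  have h : (1 - Q.f .downlink) * Q.tauBU =
      Q.tau .beacon * Q.f .beacon + Q.tau .uplink * Q.f .uplink := by
    have hsum := Q.sum_f
    rw [show 1 - Q.f .downlink = Q.f .beacon + Q.f .uplink by linarith, tauBU]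
    rcases eq_or_ne (Q.f .beacon + Q.f .uplink) 0 with h0 | h0
    · -- `tauBU` is a division by zero here, with vanishing numerator
      have hB : Q.f .beacon = 0 := by linarith [Q.f_nonneg .beacon, Q.f_nonneg .uplink]
      have hU : Q.f .uplink = 0 := by linarith [Q.f_nonneg .beacon, Q.f_nonneg .uplink]
      simp [hB, hU]
    · rw [mul_div_cancel₀ _ h0]
  rw [div_mul_eq_mul_div, h, meanCycle, TrafficClass.sum_univ]
  field_simp
  ring

theorem one_sub_mul_tauBU_of_uplink_eq_zero (Q : DownlinkChannel μ) (hU : Q.f .uplink = 0) :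
    (1 - Q.f .downlink) * Q.tauBU = (1 - Q.f .downlink) * Q.tau .beacon := by
  have hsum := Q.sum_f
  rw [hU, zero_add] at hsum
  rw [show 1 - Q.f .downlink = Q.f .beacon by linarith, tauBU, hU, mul_zero, add_zero, add_zero]
  rcases eq_or_ne (Q.f .beacon) 0 with h0 | h0
  · simp [h0]
  · rw [mul_div_cancel_right₀ _ h0]

end DownlinkChannel

theorem proposition2 {Ω : Type*} [MeasurableSpace Ω] (μ : Measure Ω) [IsProbabilityMeasure μ]
    (c d : ℕ) (hdc : d < c)
    (air ground : ℕ → DownlinkChannel μ)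
    (aA RA : ℕ → ℝ) (aG RG : ℕ → ℝ)
    -- the downlink queues are scheduled, and UAVs send only downlink and beacon packets to ground
    (hfA : ∀ i ∈ Finset.Icc (d + 1) c, 0 < (air i).f .downlink)
    (hfG : 0 < (ground d).f .downlink)
    (hfGU : (ground d).f .uplink = 0)
    -- steady state
    (hA : ∀ i ∈ Finset.Icc (d + 1) c, (air i).SteadyState (aA i) (RA i))
    (hG : (ground d).SteadyState (aG d) (RG d))
    -- stability
    (hstabA : ∀ i ∈ Finset.Icc (d + 1) c,
      aA i * ((air i).tau .downlink +
        (1 - (air i).f .downlink) / (air i).f .downlink * (air i).tauBU) < 1)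
    (hstabG : aG d * ((ground d).tau .downlink +
        (1 - (ground d).f .downlink) / (ground d).f .downlink * (ground d).tau .beacon) < 1) :
    IsMeanDownlinkDelay air ground c d
      (∑ i ∈ Finset.Icc (d + 1) c,
        ((RA i + (1 - (air i).f .downlink) / (air i).f .downlink * (air i).tauBU) /
            (1 - aA i * ((air i).tau .downlink +
              (1 - (air i).f .downlink) / (air i).f .downlink * (air i).tauBU))
          + (air i).tau .downlink)
      + ((RG d + (1 - (ground d).f .downlink) / (ground d).f .downlink * (ground d).tau .beacon) /
            (1 - aG d * ((ground d).tau .downlink +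
              (1 - (ground d).f .downlink) / (ground d).f .downlink * (ground d).tau .beacon))
          + (ground d).tau .downlink)) := by
  have key : ∀ (Q : DownlinkChannel μ) (a R g : ℝ), 0 < Q.f .downlink → Q.SteadyState a R →
      (1 - Q.f .downlink) / Q.f .downlink * Q.tauBU = g → a * (Q.tau .downlink + g) < 1 →
      HasMean μ Q.sojourn ((R + g) / (1 - a * (Q.tau .downlink + g)) + Q.tau .downlink) := by
    rintro Q a R g hf hQ rfl hstab
    rw [← Q.meanCycle_div hf] at hstab ⊢
    convert hQ.hasMean_sojourn hf hstab using 4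
    rw [Q.meanCycle_div hf, add_sub_cancel_left]
  refine ⟨fun _ => _, _, fun i hi => key (air i) _ _ _ (hfA i hi) (hA i hi) rfl (hstabA i hi),
    key (ground d) _ _ _ hfG hG ?_ hstabG, ?_⟩
  · rw [div_mul_eq_mul_div, div_mul_eq_mul_div, (ground d).one_sub_mul_tauBU_of_uplink_eq_zero hfGU]
  · rfl
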